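/- Let $G,H,E,F$ be real Banach spaces, $X\subseteq G$ and $Y\subseteq H$ open, $1\le p\le\infty$, $0\le q\le\infty$, and write $\mathbb N_p=\{k\in\mathbb N\cup\{0\}: k\le p\}$. For $k\in\mathbb N_p$ let $\mathcal S^k(G,E)$ be the Banach space of bounded symmetric $k$-linear maps $G^k\to E$ with the operator norm ($\mathcal S^0(G,E)=E$). Let $C^p(X,E)$ be the space of $p$ times continuously Fréchet differentiable functions $f:X\to E$, with derivatives $D^kf:X\to\mathcal S^k(G,E)$ ($k\in\mathbb N_p$, $D^0f=f$), endowed with the linear topology generated by the seminorms $$\rho_{K,k}(f)=\sup_{x\in K}\ \sup_{0\le j\le k}\|D^jf(x)\|,\qquad K\subseteq X\text{ compact},\ k\in\mathbb N_p,$$ and similarly for $C^q(Y,F)$; put $C^p(X)=C^p(X,\mathbb R)$. Assume that there is $\varphi\in C^p(G,\mathbb R)$ with $\varphi(x)=1$ for $\|x\|\le 1/2$, $\varphi(x)=0$ for $\|x\|\ge1$, and $\sup_{x\in G}\|D^k\varphi(x)\|<\infty$ for all $k\in\mathbb N_p$. Let $\mathbb R_\infty$ be the one-point compactification of $\mathbb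 R$, let $i:X\to\mathbb R_\infty^{C^p(X)}$ be $i(x)(\varphi)=\varphi(x)$, and let $\mathcal AX$ be the closure of $i(X)$ in $\mathbb R_\infty^{C^p(X)}$. Let $T:C^p(X,E)\to C^q(Y,F)$ be a continuous linear operator that is disjointness preserving (if for every $x\in X$ we have $f(x)=0$ or $g(x)=0$, then for every $y\in Y$ we have $Tf(y)=0$ or $Tg(y)=0$) and nowhere trivial (for every $y\in Y$ there is $f\in C^p(X,E)$ with $Tf(y)\ne0$). A support map of $T$ is a continuous map $\tilde h:Y\to\mathcal AX$ such that $Tf(y)=0$ whenever $f\in C^p(X,E)$, $y\in Y$ and $\tilde h(y)\notin\overline{i(\{x\in X:f(x)\ne0\})}^{\mathcal AX}$. Then $T$ has exactly one support map, and it is of the form $i\circ h$ with $h:Y\to X$ continuous. Moreover, there are functions $\Phi_k:Y\times\mathcal S^k(G,E)\to F$, $k\in\mathbb N_p$, such that: 1. for all $f\in C^p(X,E)$ and $y\in Y$, $\ Tf(y)=\sum_{k\in\mathbb N_p}\Phi_k\bigl(y,D^kf(h(y))\bigr)$; 2. for each $k\in\mathbb N_p$ and $y\in Y$, $\Phi_k(y,\cdot):\mathcal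 S^k(G,E)\to F$ is a bounded linear operator; 3. for each $k\in\mathbb N_p$ and $S\in\mathcal S^k(G,E)$, $\Phi_k(\cdot,S):Y\to F$ is continuous; 4. for every $y_0\in Y$ there are $r>0$ with $B(y_0,r)\subseteq Y$ and $k_0\in\mathbb N_p$ such that $\Phi_k(y,\cdot)=0$ for all $k\in\mathbb N_p$ with $k>k_0$ and all $y\in B(y_0,r)$, and such that $\sup_{y\in B(y_0,r)}\|\Phi_k(y,\cdot)\|<\infty$ for each $k\le k_0$. -/

import Mathlib

open Set Topology TopologicalSpace

noncomputable section

universe u v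

/-- The subspace of symmetric maps in the space of bounded `k`-linear maps from `G ^ k` to `E`. -/
def symSubmodule (k : ℕ) (G : Type u) (E : Type v) [NormedAddCommGroup G] [NormedSpace ℝ G]
    [NormedAddCommGroup E] [NormedSpace ℝ E] :
    Submodule ℝ (ContinuousMultilinearMap ℝ (fun _ : Fin k => G) E) where
  carrier := {S | ∀ (σ : Equiv.Perm (Fin k)) (v : Fin k → G), S (v ∘ σ) = S v}
  add_mem' := by
    intro S T hS hT σ v
    simp [hS σ v, hT σ v]
  zero_mem' := by
    intro σ v
    simp
  smul_mem' := by
    intro c S hS σ v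
    simp [hS σ v]

/-- The space of bounded symmetric `k`-linear maps from `G ^ k` to `E`, with the operator norm. -/
def SymMultilinear (k : ℕ) (G : Type u) (E : Type v) [NormedAddCommGroup G] [NormedSpace ℝ G]
    [NormedAddCommGroup E] [NormedSpace ℝ E] : Type (max u v) :=
  symSubmodule k G E

section Symmetry

variable {G : Type u} {E : Type v} [NormedAddCommGroup G] [NormedSpace ℝ G]
  [NormedAddCommGroup E] [NormedSpace ℝ E]

instance (k : ℕ) : NormedAddCommGroup (SymMultilinear k G E) :=
  inferInstanceAs (NormedAddCommGroup (symSubmodule k G E))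

instance (k : ℕ) : NormedSpace ℝ (SymMultilinear k G E) :=
  inferInstanceAs (NormedSpace ℝ (symSubmodule k G E))

/-- The value of `D^(n+2) f` when the first two arguments are displayed. -/
theorem iteratedFDeriv_add_two_apply {f : G → E} {n : ℕ} {x : G} (v : Fin (n + 2) → G) :
    iteratedFDeriv ℝ (n + 2) f x v
      = fderiv ℝ (fderiv ℝ (iteratedFDeriv ℝ n f)) x (v 0) (v 1) (fun i => v i.succ.succ) := by
  have h : fderiv ℝ (iteratedFDeriv ℝ (n + 1) f) x
      = ((continuousMultilinearCurryLeftEquiv ℝ (fun _ : Fin (n + 1) => G) E).symm :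
          _ →L[ℝ] _) ∘L fderiv ℝ (fderiv ℝ (iteratedFDeriv ℝ n f)) x := by
    rw [iteratedFDeriv_succ_eq_comp_left]
    exact LinearIsometryEquiv.comp_fderiv (𝕜 := ℝ)
      (E := G →L[ℝ] ContinuousMultilinearMap ℝ (fun _ : Fin n => G) E)
      (F := ContinuousMultilinearMap ℝ (fun _ : Fin (n + 1) => G) E)
      (G := G) (f := fderiv ℝ (iteratedFDeriv ℝ n f)) (x := x)
      (continuousMultilinearCurryLeftEquiv ℝ (fun _ : Fin (n + 1) => G) E).symm
  rw [iteratedFDeriv_succ_apply_left, h]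
  rfl

/-- The `n`-th derivative of a `C^n` function at a point is symmetric. -/
theorem iteratedFDeriv_symmetric {f : G → E} : ∀ (n : ℕ) {x : G}, ContDiffAt ℝ n f x →
    ∀ (σ : Equiv.Perm (Fin n)) (v : Fin n → G),
      iteratedFDeriv ℝ n f x (v ∘ σ) = iteratedFDeriv ℝ n f x v := by
  intro n
  induction n with
  | zero =>
    intro x _ σ v
    congr 1
    exact Subsingleton.elim _ _
  | succ n ih =>
    intro x hf σ
    have hσ : σ ∈ Submonoid.closure
        (Set.range fun i : Fin n => Equiv.swap i.castSucc i.succ) := by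
      rw [Equiv.Perm.mclosure_swap_castSucc_succ]
      trivial
    induction hσ using Submonoid.closure_induction with
    | one =>
      intro v
      rfl
    | mul a b _ _ ha hb =>
      intro v
      have : v ∘ ((a * b : Equiv.Perm (Fin (n + 1))) : Fin (n + 1) → Fin (n + 1))
          = (v ∘ a) ∘ b := rfl
      rw [this, hb, ha]
    | mem s hs =>
      obtain ⟨i, rfl⟩ := hs
      intro v
      dsimp only
      cases n with
      | zero => exact i.elim0
      | succ m =>
        refine Fin.cases ?_ (fun j => ?_) i
        · rw [iteratedFDeriv_add_two_apply, iteratedFDeriv_add_two_apply]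
          have h2 : ContDiffAt ℝ 2 (iteratedFDeriv ℝ m f) x := by
            apply hf.iteratedFDeriv_right
            norm_cast
            omega
          have hs := (h2.isSymmSndFDerivAt (by simp)).eq (v 1) (v 0)
          have e0 : (Equiv.swap (Fin.castSucc (0 : Fin (m + 1))) (Fin.succ 0)) 0
              = (1 : Fin (m + 2)) := Equiv.swap_apply_left _ _
          have e1 : (Equiv.swap (Fin.castSucc (0 : Fin (m + 1))) (Fin.succ 0)) 1
              = (0 : Fin (m + 2)) := Equiv.swap_apply_right _ _
          have e2 : ∀ l : Fin m,
              (Equiv.swap (Fin.castSucc (0 : Fin (m + 1))) (Fin.succ 0)) l.succ.succ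
              = l.succ.succ := by
            intro l
            apply Equiv.swap_apply_of_ne_of_ne
            · exact Fin.succ_ne_zero _
            · intro h
              exact Fin.succ_ne_zero _ (Fin.succ_injective _ h)
          simp only [Function.comp_apply, e0, e1, e2]
          rw [hs]
        · rw [iteratedFDeriv_succ_apply_left, iteratedFDeriv_succ_apply_left]
          set τ : Equiv.Perm (Fin (m + 1)) := Equiv.swap j.castSucc j.succ with hτ
          have hev : iteratedFDeriv ℝ (m + 1) f =ᶠ[𝓝 x]
              (ContinuousMultilinearMap.domDomCongrₗᵢ ℝ G E τ) ∘
                iteratedFDeriv ℝ (m + 1) f := by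
            have hle : ((m + 1 : ℕ) : WithTop ℕ∞) ≤ ((m + 1 + 1 : ℕ) : WithTop ℕ∞) := by
              norm_cast
              omega
            have := (hf.of_le hle).eventually (by simp)
            filter_upwards [this] with y hy
            ext w
            exact (ih hy τ w).symm
          have hd : fderiv ℝ (iteratedFDeriv ℝ (m + 1) f) x (v 0)
              = ContinuousMultilinearMap.domDomCongrₗᵢ ℝ G E τ
                  (fderiv ℝ (iteratedFDeriv ℝ (m + 1) f) x (v 0)) := by
            conv_lhs => rw [hev.fderiv_eq, LinearIsometryEquiv.comp_fderiv]
            rfl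
          have e0 : (Equiv.swap (Fin.castSucc (Fin.succ j)) (Fin.succ (Fin.succ j))) 0
              = (0 : Fin (m + 2)) := by
            apply Equiv.swap_apply_of_ne_of_ne
            · intro h
              exact Fin.succ_ne_zero j.castSucc h.symm
            · exact (Fin.succ_ne_zero _).symm
          have e1 : ∀ l : Fin (m + 1),
              (Equiv.swap (Fin.castSucc (Fin.succ j)) (Fin.succ (Fin.succ j))) l.succ
              = (τ l).succ := by
            intro l
            have := (Fin.succ_injective (m + 1)).swap_apply j.castSucc j.succ l
            exact this
          have e2 : Fin.tail (v ∘ Equiv.swap (Fin.castSucc (Fin.succ j)) (Fin.succ (Fin.succ j)))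
              = Fin.tail v ∘ τ := by
            funext l
            simp only [Fin.tail, Function.comp_apply, e1]
          rw [e2, Function.comp_apply, e0]
          conv_rhs => rw [hd]
          rfl

end Symmetry

section Spaces

variable {G : Type u} [NormedAddCommGroup G] [NormedSpace ℝ G]

/-- The set of orders of differentiation `k ∈ ℕ`, `k ≤ p`. -/
abbrev Orders (p : ℕ∞) : Type := {k : ℕ // (k : ℕ∞) ≤ p}

instance (p : ℕ∞) : Nonempty (Orders p) := ⟨⟨0, by simp⟩⟩

/-- Extension of a function on `X` by zero. Since `X` is open, the derivatives at points of `X`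
do not depend on the values outside of `X`. -/
def zeroExt {X : Opens G} {E : Type v} [Zero E] (f : X → E) : G → E :=
  Function.extend ((↑) : X → G) f 0

set_option linter.unusedSectionVars false in
theorem zeroExt_apply {X : Opens G} {E : Type v} [Zero E] (f : X → E) (x : X) :
    zeroExt f (x : G) = f x :=
  Subtype.val_injective.extend_apply f 0 x

theorem zeroExt_add {X : Opens G} {E : Type v} [AddCommGroup E] (f g : X → E) :
    zeroExt (f + g) = zeroExt f + zeroExt g := by
  funext x
  by_cases hx : x ∈ X
  · have h : ∀ u : X → E, zeroExt u x = u ⟨x, hx⟩ := fun u => zeroExt_apply u ⟨x, hx⟩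
    simp only [Pi.add_apply, h]
  · have h : ∀ u : X → E, zeroExt u x = 0 := fun u =>
      Function.extend_apply' (f := ((↑) : X → G)) u 0 x (fun ⟨a, ha⟩ => hx (ha ▸ a.2))
    simp only [Pi.add_apply, h, add_zero]

theorem zeroExt_smul {X : Opens G} {E : Type v} [AddCommGroup E] [Module ℝ E] (c : ℝ)
    (f : X → E) : zeroExt (c • f) = c • zeroExt f := by
  funext x
  by_cases hx : x ∈ X
  · have h : ∀ u : X → E, zeroExt u x = u ⟨x, hx⟩ := fun u => zeroExt_apply u ⟨x, hx⟩
    simp only [Pi.smul_apply, h]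
  · have h : ∀ u : X → E, zeroExt u x = 0 := fun u =>
      Function.extend_apply' (f := ((↑) : X → G)) u 0 x (fun ⟨a, ha⟩ => hx (ha ▸ a.2))
    simp only [Pi.smul_apply, h, smul_zero]

variable (p : ℕ∞) (X : Opens G) (E : Type v) [NormedAddCommGroup E] [NormedSpace ℝ E]

/-- The vector space of functions `X → E` that are `p` times continuously differentiable. -/
def cpSubmodule : Submodule ℝ (X → E) where
  carrier := {f | ContDiffOn ℝ (p : WithTop ℕ∞) (zeroExt f) (X : Set G)}
  add_mem' := by
    intro f g hf hg
    have := ContDiffOn.add hf hg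
    rw [Set.mem_ofPred_eq, zeroExt_add]
    exact this
  zero_mem' := by
    have h : zeroExt (0 : X → E) = 0 := by
      have := zeroExt_smul (0 : ℝ) (0 : X → E)
      simpa using this
    rw [Set.mem_ofPred_eq, h]
    exact contDiffOn_const
  smul_mem' := by
    intro c f hf
    have := ContDiffOn.const_smul c hf
    rw [Set.mem_ofPred_eq, zeroExt_smul]
    exact this

/-- The space `C^p(X, E)`. (A separate type, so as not to carry the topology of pointwise
convergence.) -/
def Cp : Type (max u v) := cpSubmodule p X E

instance : AddCommGroup (Cp p X E) := inferInstanceAs (AddCommGroup (cpSubmodule p X E))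

instance : Module ℝ (Cp p X E) := inferInstanceAs (Module ℝ (cpSubmodule p X E))

instance : FunLike (Cp p X E) X E where
  coe f := f.1
  coe_injective := fun _ _ h => Subtype.ext h

variable {p X E}

theorem Cp.contDiffAt (f : Cp p X E) (k : Orders p) (x : X) :
    ContDiffAt ℝ (k.1 : WithTop ℕ∞) (zeroExt f) (x : G) := by
  have h : ContDiffOn ℝ (p : WithTop ℕ∞) (zeroExt f) (X : Set G) := f.2
  have hk : (k.1 : WithTop ℕ∞) ≤ (p : WithTop ℕ∞) := by exact_mod_cast k.2
  exact (h.contDiffAt (X.isOpen.mem_nhds x.2)).of_le hk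

/-- The derivative `D^k f (x)`, a bounded symmetric `k`-linear map. -/
def Cp.deriv (f : Cp p X E) (k : Orders p) (x : X) : SymMultilinear k.1 G E :=
  ⟨iteratedFDeriv ℝ k.1 (zeroExt f) (x : G), iteratedFDeriv_symmetric k.1 (f.contDiffAt k x)⟩

theorem Cp.deriv_add (f g : Cp p X E) (k : Orders p) (x : X) :
    (f + g).deriv k x = f.deriv k x + g.deriv k x := by
  apply Subtype.ext
  have h : zeroExt (f + g : Cp p X E) = zeroExt f + zeroExt g := zeroExt_add f g
  change iteratedFDeriv ℝ k.1 (zeroExt (f + g : Cp p X E)) (x : G) = _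
  rw [h]
  exact iteratedFDeriv_add_apply (f.contDiffAt k x) (g.contDiffAt k x)

theorem Cp.deriv_smul (c : ℝ) (f : Cp p X E) (k : Orders p) (x : X) :
    (c • f).deriv k x = c • f.deriv k x := by
  apply Subtype.ext
  have h : zeroExt (c • f : Cp p X E) = c • zeroExt f := zeroExt_smul c f
  change iteratedFDeriv ℝ k.1 (zeroExt (c • f : Cp p X E)) (x : G) = _
  rw [h]
  exact iteratedFDeriv_const_smul_apply (f.contDiffAt k x)

theorem Cp.continuous_deriv (f : Cp p X E) (k : Orders p) : Continuous (f.deriv k) := by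
  rw [continuous_iff_continuousAt]
  intro x
  have h : ContDiffAt ℝ 0 (iteratedFDeriv ℝ k.1 (zeroExt f)) (x : G) :=
    (f.contDiffAt k x).iteratedFDeriv_right (by simp)
  have h2 : ContinuousAt (fun z : X => iteratedFDeriv ℝ k.1 (zeroExt f) (z : G)) x :=
    ContinuousAt.comp (f := ((↑) : X → G)) h.continuousAt continuous_subtype_val.continuousAt
  exact Topology.IsInducing.subtypeVal.continuousAt_iff.2 h2

theorem Cp.bddAbove_deriv (K : Compacts X) (k : Orders p) (f : Cp p X E) :
    BddAbove (Set.range fun z : K × Set.Iic k => ‖f.deriv z.2 z.1‖) := by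
  have hfin : (Set.Iic k).Finite := by
    apply Set.Finite.of_finite_image (f := Subtype.val) _ Subtype.val_injective.injOn
    apply (Set.finite_Iic k.1).subset
    rintro _ ⟨j, hj, rfl⟩
    exact hj
  have hb : BddAbove (⋃ j ∈ Set.Iic k, (fun x => ‖f.deriv j x‖) '' (K : Set X)) := by
    rw [hfin.bddAbove_biUnion]
    intro j _
    exact (K.isCompact.image (f.continuous_deriv j).norm).bddAbove
  apply hb.mono
  rintro _ ⟨⟨x, j⟩, rfl⟩
  exact Set.mem_biUnion j.2 ⟨x, x.2, rfl⟩

/-- The seminorm `ρ_{K,k}(f) = sup_{x ∈ K} sup_{0 ≤ j ≤ k} ‖D^j f (x)‖`, for `K ⊆ X` compact and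
`k ≤ p`. -/
def Cp.rho (K : Compacts X) (k : Orders p) : Seminorm ℝ (Cp p X E) :=
  Seminorm.of (fun f => ⨆ z : K × Set.Iic k, ‖f.deriv z.2 z.1‖)
    (by
      intro f g
      rcases isEmpty_or_nonempty (K × Set.Iic k) with h | h
      · simp
      · apply ciSup_le
        intro z
        rw [Cp.deriv_add]
        exact (norm_add_le _ _).trans (add_le_add
          (le_ciSup (Cp.bddAbove_deriv K k f) z) (le_ciSup (Cp.bddAbove_deriv K k g) z)))
    (by
      intro c f
      rw [Real.mul_iSup_of_nonneg (norm_nonneg c)]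
      congr 1
      funext z
      rw [Cp.deriv_smul, norm_smul])

variable (p X E) in
/-- The family of all seminorms `ρ_{K,k}`. -/
def Cp.seminorms : SeminormFamily ℝ (Cp p X E) (Compacts X × Orders p) :=
  fun i => Cp.rho i.1 i.2

/-- The linear topology of `C^p(X, E)` generated by the seminorms `ρ_{K,k}`. -/
instance : TopologicalSpace (Cp p X E) := (Cp.seminorms p X E).moduleFilterBasis.topology

theorem Cp.withSeminorms : WithSeminorms (Cp.seminorms p X E) := ⟨rfl⟩

/-- `G` has a `C^p` bump function with bounded derivatives. -/
def HasBump (p : ℕ∞) (G : Type u) [NormedAddCommGroup G] [NormedSpace ℝ G] : Prop :=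
  ∃ φ : G → ℝ, ContDiff ℝ (p : WithTop ℕ∞) φ ∧ (∀ x, ‖x‖ ≤ 1 / 2 → φ x = 1) ∧
    (∀ x, 1 ≤ ‖x‖ → φ x = 0) ∧
    ∀ k : ℕ, (k : ℕ∞) ≤ p → ∃ C : ℝ, ∀ x, ‖iteratedFDeriv ℝ k φ x‖ ≤ C

/-- The map `i : X → ℝ_∞ ^ C^p(X)`, `i(x)(φ) = φ(x)`, where `ℝ_∞` is the one-point
compactification of `ℝ`. -/
def evalPoint (p : ℕ∞) (X : Opens G) (x : X) : Cp p X ℝ → OnePoint ℝ :=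
  fun φ => ((φ x : ℝ) : OnePoint ℝ)

/-- The `C^p(X)`-compactification of `X`: the closure of `i(X)` in `ℝ_∞ ^ C^p(X)`. -/
abbrev CpCompactification (p : ℕ∞) (X : Opens G) : Type _ :=
  closure (Set.range (evalPoint p X))

/-- The map `i`, as a map from `X` to its `C^p(X)`-compactification. -/
def toCompactification (p : ℕ∞) (X : Opens G) (x : X) : CpCompactification p X :=
  ⟨evalPoint p X x, subset_closure (Set.mem_range_self x)⟩

end Spaces

section Operators

universe w z

variable {G : Type u} {E : Type v} {H : Type w} {F : Type z}
  [NormedAddCommGroup G] [NormedSpace ℝ G] [NormedAddCommGroup E] [NormedSpace ℝ E]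
  [NormedAddCommGroup H] [NormedSpace ℝ H] [NormedAddCommGroup F] [NormedSpace ℝ F]
  {p q : ℕ∞} {X : Opens G} {Y : Opens H}

/-- `T` maps disjoint functions to disjoint functions. -/
def IsSeparating (T : Cp p X E →L[ℝ] Cp q Y F) : Prop :=
  ∀ f g : Cp p X E, (∀ x, f x = 0 ∨ g x = 0) → ∀ y, T f y = 0 ∨ T g y = 0

/-- No point evaluation annihilates the range of `T`. -/
def IsNowhereTrivial (T : Cp p X E →L[ℝ] Cp q Y F) : Prop :=
  ∀ y, ∃ f, T f y ≠ 0

/-- `h` is a support map of `T`: a continuous map from `Y` to the `C^p(X)`-compactification of `X`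
such that `T f (y) = 0` whenever `h(y)` is not in the closure of `i({f ≠ 0})` in the
compactification. -/
def IsSupportMap (T : Cp p X E →L[ℝ] Cp q Y F) (h : Y → CpCompactification p X) : Prop :=
  Continuous h ∧ ∀ (f : Cp p X E) (y : Y),
    h y ∉ closure (toCompactification p X '' {x | f x ≠ 0}) → T f y = 0

end Operators

end

/-!
For fixed `y`, the map `f ↦ T f y` is a vector-valued distribution on `X`: it is controlled by
finitely many derivatives on a compact set (`exists_norm_apply_le`). Cutting off with scaled bump
functions shows that its support is nonempty because `T` is nowhere trivial
(`IsNowhereTrivial.exists_isSupportPoint`), while two distinct support points would produce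
disjoint functions whose images are both nonzero at `y` (`IsSeparating.isSupportPoint_unique`). So
the support is one point `h y`, and `T f y = 0` whenever `f` vanishes near `h y`. From this, `h` is
continuous, `i ∘ h` is a support map, and any other support map agrees with it, since the
coordinates `φ ∈ C^p(X)` tell `i (h y)` from any other point of the compactification.

A distribution of order `n` supported at a point depends only on the `n`-jet there. If the
derivatives of `f` up to order `n` vanish at `a`, then `D^i f(x) = o(‖x - a‖ ^ (n - i))`, which
compensates the growth of the derivatives of a cutoff of small radius, so `f` agrees near `a` with
functions that are arbitrarily small in `C^n` (`Cp.exists_cutoff_norm_deriv_le`). This step uses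
that the bump function has bounded derivatives. Hence `T f y` equals the value at `y` of `T` on the
Taylor polynomial of `f` at `h y`, and the operator `Φ_k(y, ·)` sends `S` to the value at `y` of
`T` on the monomial `x ↦ S(x - h y, …, x - h y) / k!` (`coefficient`); it vanishes for `k > n` because the monomial is then flat to order `n`.

The order `n` and the bounds are uniform on compact sets of `y`. As a convergent sequence with its
limit is compact, they are uniform on a small ball as well, and continuity of the coefficients
also follows along sequences.
-/

noncomputable section

universe u v w z

/-! ### Cutoff functions -/

section Cutoff

variable {G : Type u} [NormedAddCommGroup G] [NormedSpace ℝ G]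

/-- A bump function can be centred and scaled at will; the `k`-th derivative of the function of
radius `r` is `O(r ^ (-k))`, with constants that depend on neither the centre nor the radius. -/
theorem HasBump.exists_cutoff {p : ℕ∞} (hG : HasBump p G) :
    ∃ M : ℕ → ℝ, ∀ (a : G) (r : ℝ), 0 < r → ∃ χ : G → ℝ, ContDiff ℝ (p : WithTop ℕ∞) χ ∧
      (∀ x, ‖x - a‖ ≤ r / 2 → χ x = 1) ∧ (∀ x, r ≤ ‖x - a‖ → χ x = 0) ∧
      ∀ k : ℕ, (k : ℕ∞) ≤ p → ∀ x, ‖iteratedFDeriv ℝ k χ x‖ ≤ M k * r⁻¹ ^ k := by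
  obtain ⟨φ, hφ, h1, h0, hb⟩ := hG
  choose! M hM using hb
  refine ⟨M, fun a r hr => ?_⟩
  have hnorm : ∀ x : G, ‖r⁻¹ • (x - a)‖ = ‖x - a‖ / r := fun x => by
    rw [norm_smul, Real.norm_of_nonneg (inv_nonneg.2 hr.le), div_eq_inv_mul]
  let L : G →L[ℝ] G := r⁻¹ • ContinuousLinearMap.id ℝ G
  have hLn : ‖L‖ ≤ r⁻¹ := by
    refine (norm_smul_le r⁻¹ (ContinuousLinearMap.id ℝ G)).trans ?_
    rw [Real.norm_of_nonneg (inv_nonneg.2 hr.le)]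
    exact mul_le_of_le_one_right (inv_nonneg.2 hr.le) ContinuousLinearMap.norm_id_le
  refine ⟨fun x => (φ ∘ L) (x - a), ?_, fun x hx => ?_, fun x hx => ?_, fun k hk x => ?_⟩
  · exact (hφ.comp L.contDiff).comp (contDiff_id.sub contDiff_const)
  · apply h1
    change ‖r⁻¹ • (x - a)‖ ≤ _
    rw [hnorm, div_le_iff₀ hr]
    linarith
  · apply h0
    change _ ≤ ‖r⁻¹ • (x - a)‖
    rwa [hnorm, le_div_iff₀ hr, one_mul]
  · rw [iteratedFDeriv_comp_sub, L.iteratedFDeriv_comp_right hφ _ (by exact_mod_cast hk)]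
    refine (ContinuousMultilinearMap.norm_compContinuousLinearMap_le _ _).trans ?_
    rw [Finset.prod_const, Finset.card_univ, Fintype.card_fin]
    have hMk := hM k hk (L (x - a))
    exact mul_le_mul hMk (pow_le_pow_left₀ (norm_nonneg _) hLn k) (by positivity)
      ((norm_nonneg _).trans hMk)

end Cutoff

/-! ### Calculus in `C^p(X, E)` -/

namespace Cp

variable {G : Type u} [NormedAddCommGroup G] [NormedSpace ℝ G] {p : ℕ∞} {X : Opens G}
  {E : Type v} [NormedAddCommGroup E] [NormedSpace ℝ E]

theorem add_apply (f g : Cp p X E) (x : X) : (f + g) x = f x + g x := rfl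

theorem sub_apply (f g : Cp p X E) (x : X) : (f - g) x = f x - g x := rfl

theorem zero_apply (x : X) : (0 : Cp p X E) x = 0 := rfl

theorem smul_apply (c : ℝ) (f : Cp p X E) (x : X) : (c • f) x = c • f x := rfl

theorem ext {f g : Cp p X E} (h : ∀ x, f x = g x) : f = g := DFunLike.ext f g h

theorem contDiffOn (f : Cp p X E) : ContDiffOn ℝ (p : WithTop ℕ∞) (zeroExt f) (X : Set G) := f.2

protected theorem continuous (f : Cp p X E) : Continuous f :=
  (continuousOn_iff_continuous_domRestrict.1 f.contDiffOn.continuousOn).congr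
    fun x => zeroExt_apply f x

theorem deriv_neg (f : Cp p X E) (k : Orders p) (x : X) : (-f).deriv k x = -f.deriv k x := by
  simpa using Cp.deriv_smul (-1 : ℝ) f k x

theorem deriv_sub (f g : Cp p X E) (k : Orders p) (x : X) :
    (f - g).deriv k x = f.deriv k x - g.deriv k x := by
  rw [sub_eq_add_neg, Cp.deriv_add, deriv_neg, sub_eq_add_neg]

theorem deriv_sum {ι : Type*} (s : Finset ι) (f : ι → Cp p X E) (k : Orders p) (x : X) :
    (∑ i ∈ s, f i).deriv k x = ∑ i ∈ s, (f i).deriv k x :=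
  map_sum (AddMonoidHom.mk' (fun f : Cp p X E => f.deriv k x) fun f g => Cp.deriv_add f g k x) f s

/-- The element of `C^p(X, E)` given by a function on `G` that is `C^p` on `X`. -/
def restrict (g : G → E) (hg : ContDiffOn ℝ (p : WithTop ℕ∞) g (X : Set G)) : Cp p X E :=
  ⟨fun x => g x, hg.congr fun x hx => zeroExt_apply (fun x : X => g x) ⟨x, hx⟩⟩

theorem restrict_apply (g : G → E) (hg : ContDiffOn ℝ (p : WithTop ℕ∞) g (X : Set G)) (x : X) :
    restrict g hg x = g x := rfl

theorem deriv_congr_of_eventuallyEq {f : Cp p X E} {g : G → E} {x : X}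
    (h : ∀ᶠ z : X in 𝓝 x, f z = g z) (k : Orders p) :
    (f.deriv k x).1 = iteratedFDeriv ℝ k.1 g (x : G) := by
  have : zeroExt f =ᶠ[𝓝 (x : G)] g := by
    rw [← X.isOpenEmbedding'.map_nhds_eq]
    exact Filter.eventually_map.2 (h.mono fun z hz => (zeroExt_apply f z).trans hz)
  exact (this.iteratedFDeriv ℝ k.1).eq_of_nhds

theorem restrict_deriv (g : G → E) (hg : ContDiffOn ℝ (p : WithTop ℕ∞) g (X : Set G))
    (k : Orders p) (x : X) : ((restrict g hg).deriv k x).1 = iteratedFDeriv ℝ k.1 g (x : G) :=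
  deriv_congr_of_eventuallyEq (.of_forall fun _ => rfl) k

theorem deriv_eq_zero_of_eventually {f : Cp p X E} {x : X} (h : ∀ᶠ z : X in 𝓝 x, f z = 0)
    (k : Orders p) : f.deriv k x = 0 := by
  apply Subtype.ext
  rw [deriv_congr_of_eventuallyEq (g := 0) h k]
  exact congrFun iteratedFDeriv_fun_zero _

/-- The product of a `C^p` function on `G` with real values and an element of `C^p(X, E)`. -/
def cutoff (χ : G → ℝ) (hχ : ContDiff ℝ (p : WithTop ℕ∞) χ) (f : Cp p X E) : Cp p X E :=
  restrict (fun z => χ z • zeroExt f z) (hχ.contDiffOn.smul f.contDiffOn)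

theorem cutoff_apply (χ : G → ℝ) (hχ : ContDiff ℝ (p : WithTop ℕ∞) χ) (f : Cp p X E) (x : X) :
    cutoff χ hχ f x = χ x • f x := by
  rw [cutoff, restrict_apply, zeroExt_apply]

/-- The Leibniz estimate for the derivatives of a product. -/
theorem norm_deriv_cutoff_le (χ : G → ℝ) (hχ : ContDiff ℝ (p : WithTop ℕ∞) χ) (f : Cp p X E)
    (k : Orders p) (x : X) :
    ‖(cutoff χ hχ f).deriv k x‖ ≤ ∑ i ∈ Finset.range (k.1 + 1), (k.1.choose i : ℝ) *
      ‖iteratedFDeriv ℝ i χ (x : G)‖ * ‖iteratedFDeriv ℝ (k.1 - i) (zeroExt f) (x : G)‖ := by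
  have h := norm_iteratedFDerivWithin_smul_le (𝕜 := ℝ) hχ.contDiffOn f.contDiffOn
    X.isOpen.uniqueDiffOn x.2 (n := k.1) (by exact_mod_cast k.2)
  simp only [iteratedFDerivWithin_of_isOpen _ X.isOpen x.2] at h
  change ‖((cutoff χ hχ f).deriv k x).1‖ ≤ _
  rw [cutoff, restrict_deriv]
  exact h

theorem rho_le {K : Compacts X} {k : Orders p} {f : Cp p X E} {M : ℝ} (hM : 0 ≤ M)
    (h : ∀ x ∈ K, ∀ j ≤ k, ‖f.deriv j x‖ ≤ M) : Cp.rho K k f ≤ M :=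
  Real.iSup_le (fun z => h z.1 z.1.2 z.2 z.2.2) hM

theorem norm_apply_le_rho {K : Compacts X} {k : Orders p} {f : Cp p X E} {x : X} (hx : x ∈ K) :
    ‖f x‖ ≤ Cp.rho K k f := by
  have h0 : (⟨0, by simp⟩ : Orders p) ≤ k := Nat.zero_le k.1
  refine le_trans (le_of_eq ?_) (le_ciSup (Cp.bddAbove_deriv K k f) (⟨x, hx⟩, ⟨_, h0⟩))
  change _ = ‖iteratedFDeriv ℝ 0 (zeroExt f) (x : G)‖
  rw [norm_iteratedFDeriv_zero, zeroExt_apply]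

/-- Evaluation `(f, x) ↦ f x` is sequentially continuous on `C^p(X, E) × X`. -/
theorem tendsto_apply {f : ℕ → Cp p X E} {f₀ : Cp p X E} {x : ℕ → X} {x₀ : X}
    (hf : Filter.Tendsto f Filter.atTop (𝓝 f₀)) (hx : Filter.Tendsto x Filter.atTop (𝓝 x₀)) :
    Filter.Tendsto (fun n => f n (x n)) Filter.atTop (𝓝 (f₀ x₀)) := by
  let K : Compacts X := ⟨_, hx.isCompact_insert_range⟩
  have h1 : Filter.Tendsto (fun n => f n (x n) - f₀ (x n)) Filter.atTop (𝓝 0) := by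
    rw [NormedAddGroup.tendsto_nhds_zero]
    intro ε hε
    have := (Cp.withSeminorms (p := p) (X := X) (E := E)).tendsto_nhds f f₀ |>.1 hf
      (K, ⟨0, by simp⟩) ε hε
    filter_upwards [this] with n hn
    exact (norm_apply_le_rho (K := K) (f := f n - f₀) (Or.inr ⟨n, rfl⟩)).trans_lt hn
  simpa using h1.add ((f₀.continuous.tendsto x₀).comp hx)

end Cp

/-! ### Taylor monomials -/

section Monomial

variable {G : Type u} [NormedAddCommGroup G] [NormedSpace ℝ G]
  {E : Type v} [NormedAddCommGroup E] [NormedSpace ℝ E]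

/-- The homogeneous polynomial `x ↦ S(x, …, x) / k!` on `G`, normalized so that its `k`-th
derivative is `S`. -/
def divPow {k : ℕ} (S : SymMultilinear k G E) (x : G) : E :=
  (k.factorial : ℝ)⁻¹ • S.1 fun _ => x

theorem contDiff_divPow {k : ℕ} (S : SymMultilinear k G E) {n : WithTop ℕ∞} :
    ContDiff ℝ n (divPow S) :=
  (S.1.contDiff.comp (contDiff_pi.2 fun _ => contDiff_id)).const_smul _

theorem iteratedFDeriv_divPow {k : ℕ} (S : SymMultilinear k G E) (i : ℕ) (x : G) :
    iteratedFDeriv ℝ i (divPow S) x =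
      (k.factorial : ℝ)⁻¹ • iteratedFDeriv ℝ i (fun x => S.1 fun _ => x) x :=
  iteratedFDeriv_const_smul_apply (f := fun x => S.1 fun _ => x)
    ((S.1.contDiff (n := i)).comp (contDiff_pi.2 fun _ => contDiff_id)).contDiffAt

theorem iteratedFDeriv_divPow_self {k : ℕ} (S : SymMultilinear k G E) (x : G) :
    iteratedFDeriv ℝ k (divPow S) x = S.1 := by
  rw [iteratedFDeriv_divPow]
  ext v
  have h : ∀ σ : Equiv.Perm (Fin k), S.1 (fun i => v (σ i)) = S.1 v := fun σ => S.2 σ v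
  rw [_root_.smul_apply, ContinuousMultilinearMap.iteratedFDeriv_comp_diagonal]
  simp only [h, Finset.sum_const, Finset.card_univ, Fintype.card_perm, Fintype.card_fin]
  rw [← Nat.cast_smul_eq_nsmul ℝ, smul_smul,
    inv_mul_cancel₀ (Nat.cast_ne_zero.2 k.factorial_ne_zero), one_smul]

/-- This covers the vanishing of the `i`-th derivative for `i > k`, where `descFactorial k i = 0`,
and at the origin for `i < k`. -/
theorem norm_iteratedFDeriv_divPow_le {k : ℕ} (S : SymMultilinear k G E) (i : ℕ) (x : G) :
    ‖iteratedFDeriv ℝ i (divPow S) x‖ ≤ (k.descFactorial i : ℝ) * ‖S‖ * ‖x‖ ^ (k - i) := by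
  let D : G →L[ℝ] (Fin k → G) := ContinuousLinearMap.pi fun _ => ContinuousLinearMap.id ℝ G
  have hD : ‖D‖ ≤ 1 := by
    refine ContinuousLinearMap.opNorm_le_bound _ zero_le_one fun x => ?_
    rw [one_mul]
    exact (pi_norm_le_iff_of_nonneg (norm_nonneg x)).2 fun _ => le_rfl
  have hDx : ‖D x‖ ≤ ‖x‖ := by simpa using D.le_of_opNorm_le hD x
  have hf : (1 : ℝ) ≤ k.factorial := by exact_mod_cast k.factorial_pos
  rw [iteratedFDeriv_divPow, norm_smul, norm_inv, Real.norm_natCast]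
  refine (mul_le_of_le_one_left (norm_nonneg _) (inv_le_one_of_one_le₀ hf)).trans ?_
  change ‖iteratedFDeriv ℝ i (S.1 ∘ D) x‖ ≤ _
  rw [D.iteratedFDeriv_comp_right (S.1.contDiff (n := i)) _ le_rfl]
  refine (ContinuousMultilinearMap.norm_compContinuousLinearMap_le _ _).trans ?_
  rw [Finset.prod_const]
  refine (mul_le_of_le_one_right (norm_nonneg _) (pow_le_one₀ (norm_nonneg _) hD)).trans ?_
  refine (S.1.norm_iteratedFDeriv_le i (D x)).trans ?_
  rw [Fintype.card_fin]
  exact mul_le_mul_of_nonneg_left (pow_le_pow_left₀ (norm_nonneg _) hDx _)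
    (mul_nonneg (Nat.cast_nonneg _) (norm_nonneg _))

variable {p : ℕ∞} {X : Opens G}

/-- The Taylor monomial `x ↦ S(x - a, …, x - a) / k!`, as an element of `C^p(X, E)`. -/
def Cp.monomial (p : ℕ∞) {X : Opens G} {k : ℕ} (a : X) (S : SymMultilinear k G E) : Cp p X E :=
  Cp.restrict (fun x => divPow S (x - a))
    ((contDiff_divPow S).comp (contDiff_id.sub contDiff_const)).contDiffOn

theorem Cp.monomial_add {k : ℕ} (a : X) (S S' : SymMultilinear k G E) :
    Cp.monomial p a (S + S') = Cp.monomial p a S + Cp.monomial p a S' :=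
  Cp.ext fun _ => smul_add _ _ _

theorem Cp.monomial_smul {k : ℕ} (a : X) (c : ℝ) (S : SymMultilinear k G E) :
    Cp.monomial p a (c • S) = c • Cp.monomial p a S :=
  Cp.ext fun _ => smul_comm _ _ _

theorem Cp.monomial_deriv {k : ℕ} (a : X) (S : SymMultilinear k G E) (i : Orders p) (x : X) :
    ((Cp.monomial p a S).deriv i x).1 = iteratedFDeriv ℝ i.1 (divPow S) ((x : G) - a) := by
  rw [Cp.monomial, Cp.restrict_deriv, iteratedFDeriv_comp_sub]

theorem Cp.norm_monomial_deriv_le {k : ℕ} (a : X) (S : SymMultilinear k G E) (i : Orders p)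
    (x : X) : ‖(Cp.monomial p a S).deriv i x‖
      ≤ (k.descFactorial i.1 : ℝ) * ‖S‖ * ‖(x : G) - a‖ ^ (k - i.1) := by
  change ‖((Cp.monomial p a S).deriv i x).1‖ ≤ _
  rw [Cp.monomial_deriv]
  exact norm_iteratedFDeriv_divPow_le S i.1 _

theorem Cp.monomial_deriv_self (k : Orders p) (a : X) (S : SymMultilinear k.1 G E) :
    (Cp.monomial p a S).deriv k a = S := by
  apply Subtype.ext
  rw [Cp.monomial_deriv, iteratedFDeriv_divPow_self]

theorem Cp.monomial_deriv_of_ne {k : ℕ} (a : X) (S : SymMultilinear k G E) {i : Orders p}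
    (hi : i.1 ≠ k) : (Cp.monomial p a S).deriv i a = 0 := by
  rw [← norm_le_zero_iff]
  refine (Cp.norm_monomial_deriv_le a S i a).trans_eq ?_
  rcases hi.lt_or_gt with h | h
  · rw [sub_self, norm_zero, zero_pow (Nat.sub_ne_zero_of_lt h), mul_zero]
  · rw [Nat.descFactorial_of_lt h, Nat.cast_zero, zero_mul, zero_mul]

theorem Cp.continuous_monomial {k : ℕ} (S : SymMultilinear k G E) :
    Continuous fun a : X => Cp.monomial p a S := by
  rw [continuous_iff_continuousAt]
  intro a₀
  refine ((Cp.withSeminorms (p := p) (X := X) (E := E)).tendsto_nhds _ _).2 fun i ε hε => ?_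
  obtain ⟨K, N⟩ := i
  have hfin : (Set.Iic N).Finite :=
    (Set.Finite.preimage Subtype.val_injective.injOn (Set.finite_Iic N.1)).subset fun _ hj => hj
  have key : ∀ j ∈ Set.Iic N, ∀ᶠ a : X in 𝓝 a₀, ∀ x ∈ K,
      ‖(Cp.monomial p a S - Cp.monomial p a₀ S).deriv j x‖ < ε / 2 := by
    intro j _
    refine K.isCompact.eventually_forall_of_forall_eventually fun x _ => ?_
    have hc : Continuous fun z : X × X =>
        ‖iteratedFDeriv ℝ j.1 (divPow S) ((z.2 : G) - z.1)
          - iteratedFDeriv ℝ j.1 (divPow S) ((z.2 : G) - a₀)‖ := by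
      have h := (contDiff_divPow S (n := j.1)).continuous_iteratedFDeriv le_rfl
      fun_prop
    have h0 := hc.tendsto (a₀, x)
    simp only [sub_self, norm_zero] at h0
    filter_upwards [h0.eventually_lt_const (half_pos hε)] with z hz
    rw [Cp.deriv_sub]
    change ‖((Cp.monomial p z.1 S).deriv j z.2).1 - ((Cp.monomial p a₀ S).deriv j z.2).1‖ < _
    rwa [Cp.monomial_deriv, Cp.monomial_deriv]
  filter_upwards [(Filter.eventually_all_finite hfin).2 key] with a ha
  exact (Cp.rho_le (half_pos hε).le fun x hx j hj => (ha j hj x hx).le).trans_lt (half_lt_self hε)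

end Monomial

/-! ### Flat functions -/

section Flat

variable {G : Type u} [NormedAddCommGroup G] [NormedSpace ℝ G]
  {E : Type v} [NormedAddCommGroup E] [NormedSpace ℝ E] {p : ℕ∞} {X : Opens G}

/-- If the derivatives of order at most `n` of `f` vanish at `a`, then the derivative of order `i`
is `o(‖x - a‖ ^ (n - i))`. -/
theorem Cp.exists_norm_iteratedFDeriv_le {f : Cp p X E} {a : X} {n : Orders p}
    (hf : ∀ i ≤ n, f.deriv i a = 0) {δ : ℝ} (hδ : 0 < δ) :
    ∃ r > 0, Metric.ball (a : G) r ⊆ X ∧ ∀ i ≤ n.1, ∀ x ∈ Metric.ball (a : G) r,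
      ‖iteratedFDeriv ℝ i (zeroExt f) x‖ ≤ δ * ‖x - a‖ ^ (n.1 - i) := by
  have hz : ∀ i ≤ n.1, iteratedFDeriv ℝ i (zeroExt f) (a : G) = 0 := fun i hi =>
    congrArg Subtype.val
      (hf ⟨i, le_trans (by exact_mod_cast hi) n.2⟩ hi)
  obtain ⟨r₁, hr₁, hX⟩ := Metric.isOpen_iff.1 X.isOpen a a.2
  have hcont : ContinuousAt (iteratedFDeriv ℝ n.1 (zeroExt f)) (a : G) :=
    ((f.contDiffAt n a).iteratedFDeriv_right (m := 0) (by simp)).continuousAt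
  obtain ⟨r₂, hr₂, hn⟩ := Metric.continuousAt_iff.1 hcont δ hδ
  have hsub : Metric.ball (a : G) (min r₁ r₂) ⊆ X :=
    (Metric.ball_subset_ball (min_le_left _ _)).trans hX
  refine ⟨min r₁ r₂, lt_min hr₁ hr₂, hsub, fun i hi => ?_⟩
  -- Downward induction on the order, by the mean value inequality on balls about `a`.
  induction hi using Nat.decreasingInduction with
  | self =>
    intro x hx
    have := hn (lt_of_lt_of_le hx (min_le_right _ _))
    rw [hz _ le_rfl, dist_zero_right] at this
    simpa using this.le
  | of_succ i hi ih =>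
    intro x hx
    have hle : ∀ z ∈ Metric.closedBall (a : G) ‖x - a‖, z ∈ Metric.ball (a : G) (min r₁ r₂) :=
      fun z hz =>
        lt_of_le_of_lt (Metric.mem_closedBall.1 hz) (by rwa [Metric.mem_ball, dist_eq_norm] at hx)
    have hmv := (convex_closedBall (a : G) ‖x - a‖).norm_image_sub_le_of_norm_fderiv_le (𝕜 := ℝ)
      (f := iteratedFDeriv ℝ i (zeroExt f)) (C := δ * ‖x - a‖ ^ (n.1 - (i + 1)))
      (x := (a : G)) (y := x) (fun z hz => ?_) (fun z hz => ?_)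
      (Metric.mem_closedBall_self (norm_nonneg _)) (by simp [dist_eq_norm])
    · rw [hz i (by omega), sub_zero, mul_assoc, ← pow_succ] at hmv
      rwa [show n.1 - i = n.1 - (i + 1) + 1 by omega]
    · have h := f.contDiffAt n ⟨z, hsub (hle z hz)⟩
      exact h.differentiableAt_iteratedFDeriv (by exact_mod_cast hi)
    · rw [norm_fderiv_iteratedFDeriv]
      refine (ih z (hle z hz)).trans ?_
      have hz' : ‖z - a‖ ≤ ‖x - a‖ := by simpa [dist_eq_norm] using hz
      gcongr

/-- An element of `C^p(X, E)` that is flat to order `n` at `a` can be made small in `C^n`, uniformly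
on `X`, by a cutoff that equals `1` near `a`: the factor `r ^ (-i)` from the `i`-th derivative of
the cutoff of radius `r` is absorbed by the factor `r ^ i` gained from flatness. -/
theorem Cp.exists_cutoff_norm_deriv_le (hG : HasBump p G) {f : Cp p X E} {a : X} {n : Orders p}
    (hf : ∀ i ≤ n, f.deriv i a = 0) {η : ℝ} (hη : 0 < η) :
    ∃ g : Cp p X E, (∀ᶠ x in 𝓝 a, g x = f x) ∧ ∀ x, ∀ j ≤ n, ‖g.deriv j x‖ ≤ η := by
  obtain ⟨M, hM⟩ := hG.exists_cutoff
  let A : ℝ := ∑ j ∈ Finset.range (n.1 + 1), ∑ i ∈ Finset.range (j + 1), (j.choose i : ℝ) * |M i|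
  have hA : 0 ≤ A := by positivity
  let δ : ℝ := η / (A + 1)
  have hδ : 0 < δ := by positivity
  obtain ⟨r, hr, -, hfr⟩ := Cp.exists_norm_iteratedFDeriv_le hf hδ
  let ε : ℝ := min (r / 2) 1
  have hε : 0 < ε := lt_min (half_pos hr) one_pos
  have hεr : ε < r := (min_le_left _ _).trans_lt (half_lt_self hr)
  have hε1 : ε ≤ 1 := min_le_right _ _
  obtain ⟨χ, hχ, h1, h0, hb⟩ := hM a ε hε
  have hcont : Continuous fun z : X => ‖(z : G) - a‖ := by fun_prop
  refine ⟨Cp.cutoff χ hχ f, ?_, fun x j hj => ?_⟩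
  · have : ∀ᶠ z : X in 𝓝 a, ‖(z : G) - a‖ < ε / 2 :=
      hcont.continuousAt.eventually_lt_const (by simpa using half_pos hε)
    filter_upwards [this] with z hz
    rw [Cp.cutoff_apply, h1 _ hz.le, one_smul]
  rcases lt_or_ge ε ‖(x : G) - a‖ with hx | hx
  · rw [Cp.deriv_eq_zero_of_eventually]
    · simpa using hη.le
    filter_upwards [hcont.continuousAt.eventually_const_lt hx] with z hz
    rw [Cp.cutoff_apply, h0 _ hz.le, zero_smul]
  have hj' : j.1 ≤ n.1 := hj
  have hterm : ∀ i ∈ Finset.range (j.1 + 1), (j.1.choose i : ℝ) *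
      ‖iteratedFDeriv ℝ i χ (x : G)‖ * ‖iteratedFDeriv ℝ (j.1 - i) (zeroExt f) (x : G)‖
      ≤ (j.1.choose i : ℝ) * |M i| * δ := by
    intro i hi
    have hij : i ≤ j.1 := Nat.lt_succ_iff.1 (Finset.mem_range.1 hi)
    have b1 : ‖iteratedFDeriv ℝ i χ (x : G)‖ ≤ |M i| * ε⁻¹ ^ i :=
      (hb i (le_trans (by exact_mod_cast hij) j.2) x).trans
        (mul_le_mul_of_nonneg_right (le_abs_self _) (by positivity))
    have b2 : ‖iteratedFDeriv ℝ (j.1 - i) (zeroExt f) (x : G)‖ ≤ δ * ε ^ i := by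
      refine (hfr (j.1 - i) (by omega) x
        (by rw [Metric.mem_ball, dist_eq_norm]; exact hx.trans_lt hεr)).trans ?_
      refine mul_le_mul_of_nonneg_left ?_ hδ.le
      refine (pow_le_pow_left₀ (norm_nonneg _) hx _).trans ?_
      exact pow_le_pow_of_le_one hε.le hε1 (by omega)
    calc _ ≤ (j.1.choose i : ℝ) * (|M i| * ε⁻¹ ^ i) * (δ * ε ^ i) := by gcongr
      _ = (j.1.choose i : ℝ) * |M i| * δ * (ε⁻¹ * ε) ^ i := by rw [mul_pow]; ring
      _ = _ := by rw [inv_mul_cancel₀ hε.ne', one_pow, mul_one]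
  refine (Cp.norm_deriv_cutoff_le χ hχ f j x).trans ((Finset.sum_le_sum hterm).trans ?_)
  rw [← Finset.sum_mul]
  have hjA : ∑ i ∈ Finset.range (j.1 + 1), (j.1.choose i : ℝ) * |M i| ≤ A :=
    Finset.single_le_sum (f := fun j => ∑ i ∈ Finset.range (j + 1), (j.choose i : ℝ) * |M i|)
      (fun _ _ => by positivity) (Finset.mem_range.2 (Nat.lt_succ_of_le hj'))
  calc _ ≤ (A + 1) * δ := by gcongr; linarith
    _ = η := mul_div_cancel₀ _ (by positivity)

end Flat

/-! ### Support and order of a separating operator -/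

section Operator

variable {G : Type u} {E : Type v} {H : Type w} {F : Type z}
  [NormedAddCommGroup G] [NormedSpace ℝ G] [NormedAddCommGroup E] [NormedSpace ℝ E]
  [NormedAddCommGroup H] [NormedSpace ℝ H] [NormedAddCommGroup F] [NormedSpace ℝ F]
  {p q : ℕ∞} {X : Opens G} {Y : Opens H}

/-- Over a compact set of points `y`, the values `T f y` are controlled by the derivatives of `f` up
to a common finite order on a common compact set. -/
theorem exists_norm_apply_le (T : Cp p X E →L[ℝ] Cp q Y F) {L : Set Y} (hL : IsCompact L) :
    ∃ (K : Compacts X) (n : Orders p) (C : ℝ), 0 ≤ C ∧ ∀ (f : Cp p X E) (M : ℝ), 0 ≤ M →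
      (∀ x ∈ K, ∀ j ≤ n, ‖f.deriv j x‖ ≤ M) → ∀ y ∈ L, ‖T f y‖ ≤ C * M := by
  let L' : Compacts Y := ⟨L, hL⟩
  let ρ : Seminorm ℝ (Cp q Y F) := Cp.rho L' ⟨0, by simp⟩
  have hρ : Continuous ρ :=
    (Cp.withSeminorms (p := q) (X := Y) (E := F)).continuous_seminorm (L', ⟨0, by simp⟩)
  have hcont : Continuous (ρ.comp T.toLinearMap) := hρ.comp T.continuous
  obtain ⟨s, C, -, hC⟩ := Seminorm.bound_of_continuous Cp.withSeminorms _ hcont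
  obtain ⟨⟨K, n⟩, hKn⟩ := s.exists_le
  refine ⟨K, n, C, C.2, fun f M hM hf y hy => ?_⟩
  calc ‖T f y‖ ≤ ρ (T f) := Cp.norm_apply_le_rho (K := L') hy
    _ ≤ C * s.sup (Cp.seminorms p X E) f := hC f
    _ ≤ C * M := by
      refine mul_le_mul_of_nonneg_left (Seminorm.finset_sup_apply_le hM fun i hi => ?_) C.2
      exact Cp.rho_le hM fun x hx j hj => hf x ((hKn i hi).1 hx) j (hj.trans (hKn i hi).2)

/-- If `f` is locally annihilated by `T` at `y`, then `T f y = 0`. A finite number of cutoffs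
reduces `f` to a function that vanishes near the compact set that controls `T` at `y`. -/
theorem apply_eq_zero_of_locally (hG : HasBump p G) (T : Cp p X E →L[ℝ] Cp q Y F)
    (f : Cp p X E) (y : Y)
    (h : ∀ x : X, ∃ r > 0, ∀ g : Cp p X E,
      (∀ z : X, g z ≠ 0 → f z ≠ 0 ∧ ‖(z : G) - x‖ < r) → T g y = 0) : T f y = 0 := by
  obtain ⟨M, hM⟩ := hG.exists_cutoff
  choose r hr hnull using h
  obtain ⟨K, n, C, -, hbd⟩ := exists_norm_apply_le T (isCompact_singleton (x := y))
  have hcont : ∀ x : X, Continuous fun z : X => ‖(z : G) - x‖ := fun x => by fun_prop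
  obtain ⟨t, -, ht⟩ := K.isCompact.elim_nhds_subcover (fun x => {z : X | ‖(z : G) - x‖ < r x / 2})
    fun x _ => (hcont x).continuousAt.eventually_lt_const (by simpa using half_pos (hr x))
  have key : ∀ (s : Finset X) (g : Cp p X E), (∀ z, g z ≠ 0 → f z ≠ 0) →
      (∀ x ∈ K, ∀ᶠ z : X in 𝓝 x, g z = 0 ∨ ∃ c ∈ s, ‖(z : G) - c‖ < r c / 2) → T g y = 0 := by
    classical
    intro s
    induction s using Finset.induction_on with
    | empty =>
      intro g _ hg
      have := hbd g 0 le_rfl (fun x hx j _ => by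
        rw [Cp.deriv_eq_zero_of_eventually, norm_zero]
        exact (hg x hx).mono fun z hz => by simpa using hz) y rfl
      simpa using this
    | insert c s _ ih =>
      intro g hgf hg
      obtain ⟨χ, hχ, h1, h0, -⟩ := hM c (r c) (hr c)
      have e1 : T (Cp.cutoff χ hχ g) y = 0 := by
        refine hnull c _ fun z hz => ?_
        rw [Cp.cutoff_apply] at hz
        exact ⟨hgf z (right_ne_zero_of_smul hz),
          lt_of_not_ge fun hzc => left_ne_zero_of_smul hz (h0 z hzc)⟩
      have e2 : T (g - Cp.cutoff χ hχ g) y = 0 := by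
        refine ih _ (fun z hz => hgf z fun h => hz ?_) fun x hx => ?_
        · rw [Cp.sub_apply, Cp.cutoff_apply, h, smul_zero, sub_zero]
        · filter_upwards [hg x hx] with z hz
          rw [Cp.sub_apply, Cp.cutoff_apply]
          rcases hz with hz | ⟨d, hd, hzd⟩
          · left
            rw [hz, smul_zero, sub_zero]
          · rcases Finset.mem_insert.1 hd with rfl | hd
            · left
              rw [h1 z hzd.le, one_smul, sub_self]
            · exact Or.inr ⟨d, hd, hzd⟩
      rw [map_sub, Cp.sub_apply, e1, sub_zero] at e2
      exact e2
  have hopen : IsOpen (⋃ x ∈ t, {z : X | ‖(z : G) - x‖ < r x / 2}) :=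
    isOpen_biUnion fun x _ => isOpen_lt (hcont x) continuous_const
  refine key t f (fun _ => id) fun x hx => ?_
  filter_upwards [hopen.mem_nhds (ht hx)] with z hz
  simpa using Or.inr (mem_iUnion₂.1 hz)

/-- The point `a` is in the support of the vector-valued distribution `f ↦ T f y`. -/
def IsSupportPoint (T : Cp p X E →L[ℝ] Cp q Y F) (y : Y) (a : X) : Prop :=
  ∀ r > 0, ∃ g : Cp p X E, (∀ z : X, g z ≠ 0 → ‖(z : G) - a‖ < r) ∧ T g y ≠ 0

theorem IsNowhereTrivial.exists_isSupportPoint (hG : HasBump p G)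
    {T : Cp p X E →L[ℝ] Cp q Y F} (hnt : IsNowhereTrivial T) (y : Y) :
    ∃ a, IsSupportPoint T y a := by
  by_contra! hne
  obtain ⟨f, hf⟩ := hnt y
  refine hf (apply_eq_zero_of_locally hG T f y fun x => ?_)
  have hx := hne x
  unfold IsSupportPoint at hx
  push Not at hx
  obtain ⟨r, hr, h⟩ := hx
  exact ⟨r, hr, fun g hg => h g fun z hz => (hg z hz).2⟩

theorem IsSeparating.isSupportPoint_unique {T : Cp p X E →L[ℝ] Cp q Y F} (hsep : IsSeparating T)
    {y : Y} {a b : X} (ha : IsSupportPoint T y a) (hb : IsSupportPoint T y b) : a = b := by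
  by_contra hab
  have hd : 0 < dist (a : G) b := dist_pos.2 fun h => hab (Subtype.ext h)
  obtain ⟨f, hf, hf0⟩ := ha _ (half_pos hd)
  obtain ⟨g, hg, hg0⟩ := hb _ (half_pos hd)
  refine (hsep f g (fun x => ?_) y).elim hf0 hg0
  by_contra! h
  have h1 := hf x h.1
  have h2 := hg x h.2
  rw [← dist_eq_norm] at h1 h2
  linarith [dist_triangle_left (a : G) b x]

theorem IsSupportPoint.apply_eq_zero (hG : HasBump p G) {T : Cp p X E →L[ℝ] Cp q Y F}
    (hsep : IsSeparating T) {y : Y} {a : X} (ha : IsSupportPoint T y a) {f : Cp p X E}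
    (hf : ∀ᶠ x in 𝓝 a, f x = 0) : T f y = 0 := by
  refine apply_eq_zero_of_locally hG T f y fun x => ?_
  by_cases hx : x = a
  · subst hx
    obtain ⟨r, hr, h⟩ := Metric.eventually_nhds_iff.1 hf
    refine ⟨r, hr, fun g hg => ?_⟩
    have : g = 0 := Cp.ext fun z => by
      by_contra hz
      obtain ⟨h1, h2⟩ := hg z hz
      exact h1 (h (by rwa [Subtype.dist_eq, dist_eq_norm]))
    rw [this, map_zero, Cp.zero_apply]
  · have hx' : ¬ IsSupportPoint T y x := fun h => hx (hsep.isSupportPoint_unique h ha)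
    unfold IsSupportPoint at hx'
    push Not at hx'
    obtain ⟨r, hr, h⟩ := hx'
    exact ⟨r, hr, fun g hg => h g fun z hz => (hg z hz).2⟩

theorem IsSupportPoint.mem_closure (hG : HasBump p G) {T : Cp p X E →L[ℝ] Cp q Y F}
    (hsep : IsSeparating T) {y : Y} {a : X} (ha : IsSupportPoint T y a) {f : Cp p X E}
    (hf : T f y ≠ 0) : a ∈ closure {x | f x ≠ 0} := by
  by_contra h
  refine hf (ha.apply_eq_zero hG hsep ?_)
  filter_upwards [isClosed_closure.isOpen_compl.mem_nhds h] with x hx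
  by_contra hne
  exact hx (subset_closure hne)

theorem continuous_of_isSupportPoint (hG : HasBump p G) {T : Cp p X E →L[ℝ] Cp q Y F}
    (hsep : IsSeparating T) {h : Y → X} (hh : ∀ y, IsSupportPoint T y (h y)) : Continuous h := by
  rw [Metric.continuous_iff']
  intro y ε hε
  obtain ⟨g, hg, hgy⟩ := hh y (ε / 2) (half_pos hε)
  filter_upwards [(T g).continuous.continuousAt.eventually_ne hgy] with z hz
  have hsub : closure {x | g x ≠ 0} ⊆ Metric.closedBall (h y) (ε / 2) :=
    closure_minimal (fun x hx => by
      rw [Metric.mem_closedBall, Subtype.dist_eq, dist_eq_norm]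
      exact (hg x hx).le) Metric.isClosed_closedBall
  exact (Metric.mem_closedBall.1 (hsub ((hh z).mem_closure hG hsep hz))).trans_lt
    (half_lt_self hε)

/-- At `y`, a separating operator of local order `n` depends only on the `n`-jet of `f` at the
support point. -/
theorem IsSupportPoint.apply_eq_zero_of_flat (hG : HasBump p G) {T : Cp p X E →L[ℝ] Cp q Y F}
    (hsep : IsSeparating T) {y : Y} {a : X} (ha : IsSupportPoint T y a) {K : Compacts X}
    {n : Orders p} {C : ℝ} (hC : 0 ≤ C)
    (hbd : ∀ (f : Cp p X E) (M : ℝ), 0 ≤ M →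
      (∀ x ∈ K, ∀ j ≤ n, ‖f.deriv j x‖ ≤ M) → ‖T f y‖ ≤ C * M)
    {f : Cp p X E} (hf : ∀ j ≤ n, f.deriv j a = 0) : T f y = 0 := by
  rw [← norm_le_zero_iff]
  refine le_of_forall_pos_le_add fun ε hε => ?_
  obtain ⟨g, hgf, hg⟩ := Cp.exists_cutoff_norm_deriv_le hG hf (η := ε / (C + 1)) (by positivity)
  have h0 : T (f - g) y = 0 := ha.apply_eq_zero hG hsep (by
    filter_upwards [hgf] with x hx
    rw [Cp.sub_apply, hx, sub_self])
  rw [map_sub, Cp.sub_apply, sub_eq_zero] at h0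
  rw [h0, zero_add]
  calc ‖T g y‖ ≤ C * (ε / (C + 1)) := hbd g _ (by positivity) fun x _ j hj => hg x j hj
    _ ≤ (C + 1) * (ε / (C + 1)) := by gcongr; linarith
    _ = ε := mul_div_cancel₀ _ (by positivity)

/-! ### Coefficients of a separating operator -/

theorem norm_monomial_deriv_le_of_norm_le {k : ℕ} {a x : X} (S : SymMultilinear k G E)
    (j : Orders p) {R : ℝ} (hR : 1 ≤ R) (hx : ‖(x : G) - a‖ ≤ R) :
    ‖(Cp.monomial p a S).deriv j x‖ ≤ k.factorial * R ^ k * ‖S‖ := by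
  refine (Cp.norm_monomial_deriv_le a S j x).trans ?_
  have h1 : k.descFactorial j.1 ≤ k.factorial := by
    rcases le_or_gt j.1 k with h | h
    · rw [← Nat.factorial_mul_descFactorial h]
      exact Nat.le_mul_of_pos_left _ (Nat.factorial_pos _)
    · simp [Nat.descFactorial_of_lt h]
  have h2 : ‖(x : G) - a‖ ^ (k - j.1) ≤ R ^ k :=
    (pow_le_pow_left₀ (norm_nonneg _) hx _).trans (pow_le_pow_right₀ hR (Nat.sub_le _ _))
  calc _ ≤ (k.factorial : ℝ) * ‖S‖ * R ^ k := by gcongr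
    _ = _ := by ring

/-- The coefficient of the `k`-th derivative at `a` in the representation of `f ↦ T f y`: the value
of `T` at `y` on the Taylor monomials of degree `k` centred at `a`. -/
def coefficient (T : Cp p X E →L[ℝ] Cp q Y F) (y : Y) (a : X) (k : ℕ) :
    SymMultilinear k G E →L[ℝ] F :=
  LinearMap.mkContinuousOfExistsBound
    { toFun := fun S => T (Cp.monomial p a S) y
      map_add' := fun S S' => by rw [Cp.monomial_add, map_add, Cp.add_apply]
      map_smul' := fun c S => by
        rw [Cp.monomial_smul, map_smul, Cp.smul_apply, RingHom.id_apply] } (by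
    obtain ⟨K, n, C, hC, hbd⟩ := exists_norm_apply_le T (isCompact_singleton (x := y))
    have hcont : Continuous fun z : X => ‖(z : G) - a‖ := by fun_prop
    obtain ⟨R, hR⟩ := (K.isCompact.image hcont).bddAbove
    refine ⟨C * (k.factorial * max R 1 ^ k), fun S => ?_⟩
    rw [mul_assoc]
    exact hbd _ _ (by positivity) (fun x hx j _ =>
      norm_monomial_deriv_le_of_norm_le S j (le_max_right _ _)
        ((hR (mem_image_of_mem _ hx)).trans (le_max_left _ _))) y rfl)

theorem coefficient_apply (T : Cp p X E →L[ℝ] Cp q Y F) (y : Y) (a : X) (k : ℕ)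
    (S : SymMultilinear k G E) : coefficient T y a k S = T (Cp.monomial p a S) y := rfl

/-- The order of `T` and the norms of its coefficients are bounded on compact sets. -/
theorem exists_coefficient_bound (hG : HasBump p G) {T : Cp p X E →L[ℝ] Cp q Y F}
    (hsep : IsSeparating T) {h : Y → X} (hh : ∀ y, IsSupportPoint T y (h y)) {L : Set Y}
    (hL : IsCompact L) : ∃ (n : Orders p) (C : ℝ), ∀ y ∈ L,
      (∀ k : Orders p, n < k → coefficient T y (h y) k.1 = 0) ∧
      ∀ k : Orders p, ‖coefficient T y (h y) k.1‖ ≤ C := by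
  obtain ⟨K, n, C, hC, hbd⟩ := exists_norm_apply_le T hL
  have hc := continuous_of_isSupportPoint hG hsep hh
  have hcont : Continuous fun z : X × Y => ‖(z.1 : G) - h z.2‖ := by fun_prop
  obtain ⟨R, hR⟩ := ((K.isCompact.prod hL).image hcont).bddAbove
  have hvan : ∀ y ∈ L, ∀ k : Orders p, n < k → coefficient T y (h y) k.1 = 0 := by
    intro y hy k hk
    ext S
    rw [coefficient_apply]
    refine (hh y).apply_eq_zero_of_flat hG hsep hC (fun f M hM hf => hbd f M hM hf y hy)
      fun j hj => Cp.monomial_deriv_of_ne _ _ (ne_of_lt (hj.trans_lt hk))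
  have hB : 0 ≤ C * (n.1.factorial * max R 1 ^ n.1) := by positivity
  refine ⟨n, C * (n.1.factorial * max R 1 ^ n.1), fun y hy => ⟨hvan y hy, fun k => ?_⟩⟩
  rcases lt_or_ge n k with hk | hk
  · rw [hvan y hy k hk, norm_zero]
    exact hB
  · refine ContinuousLinearMap.opNorm_le_bound _ hB fun S => ?_
    have hk' : k.1 ≤ n.1 := hk
    have hmono : (k.1.factorial : ℝ) * max R 1 ^ k.1 ≤ n.1.factorial * max R 1 ^ n.1 := by
      have := Nat.factorial_le hk'
      have := le_max_right R 1
      gcongr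
    rw [coefficient_apply, mul_assoc]
    refine hbd _ _ (by positivity) (fun x hx j _ => ?_) y hy
    refine (norm_monomial_deriv_le_of_norm_le S j (le_max_right _ _)
      ((hR (mem_image_of_mem (fun z : X × Y => ‖(z.1 : G) - h z.2‖)
        (show (x, y) ∈ (K : Set X) ×ˢ L from ⟨hx, hy⟩))).trans (le_max_left _ _))).trans ?_
    gcongr

/-- Compactness of convergent sequences upgrades the bounds on compact sets to bounds on a ball,
although `H` need not be locally compact. -/
theorem exists_ball_coefficient_bound (hG : HasBump p G) {T : Cp p X E →L[ℝ] Cp q Y F}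
    (hsep : IsSeparating T) {h : Y → X} (hh : ∀ y, IsSupportPoint T y (h y)) (y₀ : Y) :
    ∃ r > 0, Metric.ball (y₀ : H) r ⊆ Y ∧ ∃ N : ℕ, ∀ y : Y, (y : H) ∈ Metric.ball (y₀ : H) r →
      (∀ k : Orders p, N < k.1 → coefficient T y (h y) k.1 = 0) ∧
      ∀ k : Orders p, ‖coefficient T y (h y) k.1‖ ≤ N := by
  suffices ∃ N : ℕ, ∃ r > 0, ∀ y : Y, (y : H) ∈ Metric.ball (y₀ : H) r →
      (∀ k : Orders p, N < k.1 → coefficient T y (h y) k.1 = 0) ∧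
      ∀ k : Orders p, ‖coefficient T y (h y) k.1‖ ≤ N by
    obtain ⟨N, r, hr, hN⟩ := this
    obtain ⟨r', hr', hY⟩ := Metric.isOpen_iff.1 Y.isOpen y₀ y₀.2
    exact ⟨min r r', lt_min hr hr', (Metric.ball_subset_ball (min_le_right _ _)).trans hY, N,
      fun y hy => hN y (Metric.ball_subset_ball (min_le_left _ _) hy)⟩
  by_contra! hcon
  choose u hu hbad using fun N : ℕ => hcon N (1 / ((N : ℝ) + 1)) Nat.one_div_pos_of_nat
  have hlim : Filter.Tendsto u Filter.atTop (𝓝 y₀) := by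
    rw [tendsto_iff_dist_tendsto_zero]
    exact squeeze_zero (fun _ => dist_nonneg) (fun N => (Metric.mem_ball.1 (hu N)).le)
      tendsto_one_div_add_atTop_nhds_zero_nat
  obtain ⟨n, C, hb⟩ := exists_coefficient_bound hG hsep hh hlim.isCompact_insert_range
  obtain ⟨m, hm⟩ := exists_nat_ge C
  obtain ⟨hvan, hle⟩ := hb (u (max n.1 m)) (Or.inr ⟨_, rfl⟩)
  obtain ⟨k, hk⟩ := hbad (max n.1 m) fun k hk => hvan k ((le_max_left n.1 m).trans_lt hk)
  have : (m : ℝ) ≤ (max n.1 m : ℕ) := by exact_mod_cast le_max_right n.1 m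
  linarith [hle k]

/-- The representation holds because `f` and its Taylor polynomial at the support point have the
same jet, of any order. -/
theorem IsSupportPoint.hasSum_coefficient (hG : HasBump p G) {T : Cp p X E →L[ℝ] Cp q Y F}
    (hsep : IsSeparating T) {y : Y} {a : X} (ha : IsSupportPoint T y a) (f : Cp p X E) :
    HasSum (fun k : Orders p => coefficient T y a k.1 (f.deriv k a)) (T f y) := by
  obtain ⟨K, n, C, hC, hbd⟩ := exists_norm_apply_le T (isCompact_singleton (x := y))
  have hflat : ∀ g : Cp p X E, (∀ j ≤ n, g.deriv j a = 0) → T g y = 0 := fun g hg =>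
    ha.apply_eq_zero_of_flat hG hsep hC (fun f M hM hf => hbd f M hM hf y rfl) hg
  have hfin : (Set.Iic n).Finite :=
    (Set.Finite.preimage Subtype.val_injective.injOn (Set.finite_Iic n.1)).subset fun _ hj => hj
  let s : Finset (Orders p) := hfin.toFinset
  have hs : ∀ k, k ∈ s ↔ k ≤ n := fun k => hfin.mem_toFinset
  have hsum : T f y = ∑ k ∈ s, coefficient T y a k.1 (f.deriv k a) := by
    have h0 := hflat (f - ∑ k ∈ s, Cp.monomial p a (f.deriv k a)) fun j hj => by
      rw [Cp.deriv_sub, Cp.deriv_sum, Finset.sum_eq_single_of_mem j ((hs j).2 hj),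
        Cp.monomial_deriv_self, sub_self]
      exact fun k _ hkj => Cp.monomial_deriv_of_ne _ _ fun h => hkj (Subtype.ext h.symm)
    rw [map_sub, Cp.sub_apply, sub_eq_zero, map_sum] at h0
    rw [h0]
    exact map_sum (AddMonoidHom.mk' (fun g : Cp q Y F => g y) fun _ _ => rfl) _ s
  rw [hsum]
  refine hasSum_sum_of_ne_finset_zero fun k hk => ?_
  rw [coefficient_apply]
  refine hflat _ fun j hj => Cp.monomial_deriv_of_ne _ _ fun h => hk ((hs k).2 ?_)
  rwa [← Subtype.ext h]

theorem continuous_coefficient_apply (hG : HasBump p G) {T : Cp p X E →L[ℝ] Cp q Y F}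
    (hsep : IsSeparating T) {h : Y → X} (hh : ∀ y, IsSupportPoint T y (h y)) {k : ℕ}
    (S : SymMultilinear k G E) : Continuous fun y => coefficient T y (h y) k S := by
  rw [continuous_iff_seqContinuous]
  intro u y hu
  have hc := continuous_of_isSupportPoint hG hsep hh
  have hT : Continuous fun y => T (Cp.monomial p (h y) S) :=
    T.continuous.comp ((Cp.continuous_monomial S).comp hc)
  exact Cp.tendsto_apply ((hT.tendsto y).comp hu) hu

/-! ### The support map -/

theorem continuous_toCompactification : Continuous (toCompactification p X) :=
  Continuous.subtype_mk (continuous_pi fun φ => OnePoint.continuous_coe.comp φ.continuous) _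

theorem isSupportMap_of_isSupportPoint (hG : HasBump p G) {T : Cp p X E →L[ℝ] Cp q Y F}
    (hsep : IsSeparating T) {h : Y → X} (hh : ∀ y, IsSupportPoint T y (h y)) :
    IsSupportMap T fun y => toCompactification p X (h y) := by
  refine ⟨continuous_toCompactification.comp (continuous_of_isSupportPoint hG hsep hh),
    fun f y hy => ?_⟩
  by_contra hne
  exact hy (image_closure_subset_closure_image continuous_toCompactification
    (mem_image_of_mem _ ((hh y).mem_closure hG hsep hne)))

theorem IsSupportMap.apply_eq {T : Cp p X E →L[ℝ] Cp q Y F} {h' : Y → CpCompactification p X}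
    (hh' : IsSupportMap T h') {y : Y} {a : X} (ha : IsSupportPoint T y a) :
    h' y = toCompactification p X a := by
  refine Subtype.ext (funext fun φ => ?_)
  by_contra hne
  -- Separate the two values of the coordinate `φ`, and test with a function supported where the
  -- values of `φ` are close to `φ a`.
  obtain ⟨U, V, hU, hV, hyU, haV, hUV⟩ := t2_separation hne
  have hc : Continuous fun x : X => (toCompactification p X x).1 φ :=
    (continuous_apply φ).comp (continuous_subtype_val.comp continuous_toCompactification)
  obtain ⟨r, hr, hrV⟩ := Metric.isOpen_iff.1 (hV.preimage hc) a haV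
  obtain ⟨g, hg, hgy⟩ := ha r hr
  refine hgy (hh'.2 g y fun hcl => ?_)
  have hUo : IsOpen {e : CpCompactification p X | e.1 φ ∈ U} :=
    hU.preimage ((continuous_apply φ).comp continuous_subtype_val)
  obtain ⟨_, hxU, x, hx, rfl⟩ := mem_closure_iff.1 hcl _ hUo hyU
  have hxV : x ∈ Metric.ball a r := by
    rw [Metric.mem_ball, Subtype.dist_eq, dist_eq_norm]
    exact hg x hx
  exact disjoint_left.1 hUV hxU (hrV hxV)

end Operator

end

theorem theorem10 {G E H F : Type*}
    [NormedAddCommGroup G] [NormedSpace ℝ G] [CompleteSpace G]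
    [NormedAddCommGroup E] [NormedSpace ℝ E] [CompleteSpace E]
    [NormedAddCommGroup H] [NormedSpace ℝ H] [CompleteSpace H]
    [NormedAddCommGroup F] [NormedSpace ℝ F] [CompleteSpace F]
    (p q : ℕ∞) (hp : 1 ≤ p) (hG : HasBump p G)
    (X : Opens G) (Y : Opens H)
    (T : Cp p X E →L[ℝ] Cp q Y F) (hsep : IsSeparating T) (hnt : IsNowhereTrivial T) :
    ∃ h : Y → X, Continuous h ∧
      IsSupportMap T (fun y => toCompactification p X (h y)) ∧
      (∀ h' : Y → CpCompactification p X, IsSupportMap T h' →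
        h' = fun y => toCompactification p X (h y)) ∧
      ∃ Φ : (k : Orders p) → Y → SymMultilinear k.1 G E →L[ℝ] F,
        (∀ (f : Cp p X E) (y : Y), HasSum (fun k => Φ k y (f.deriv k (h y))) (T f y)) ∧
        (∀ (k : Orders p) (S : SymMultilinear k.1 G E), Continuous fun y => Φ k y S) ∧
        ∀ y₀ : Y, ∃ r : ℝ, 0 < r ∧ Metric.ball (y₀ : H) r ⊆ Y ∧ ∃ k₀ : Orders p,
          (∀ k, k₀ < k → ∀ y : Y, (y : H) ∈ Metric.ball (y₀ : H) r → Φ k y = 0) ∧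
          ∀ k, k ≤ k₀ → ∃ C : ℝ, ∀ y : Y, (y : H) ∈ Metric.ball (y₀ : H) r → ‖Φ k y‖ ≤ C := by
  choose h hh using fun y => hnt.exists_isSupportPoint hG y
  refine ⟨h, continuous_of_isSupportPoint hG hsep hh, isSupportMap_of_isSupportPoint hG hsep hh,
    fun h' hh' => funext fun y => hh'.apply_eq (hh y), fun k y => coefficient T y (h y) k.1,
    fun f y => (hh y).hasSum_coefficient hG hsep f,
    fun k S => continuous_coefficient_apply hG hsep hh S, fun y₀ => ?_⟩
  obtain ⟨r, hr, hY, N, hN⟩ := exists_ball_coefficient_bound hG hsep hh y₀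
  have hC : ∀ k : Orders p, ∃ C : ℝ, ∀ y : Y, (y : H) ∈ Metric.ball (y₀ : H) r →
      ‖coefficient T y (h y) k.1‖ ≤ C := fun k => ⟨N, fun y hy => (hN y hy).2 k⟩
  refine ⟨r, hr, hY, ?_⟩
  rcases le_or_gt (N : ℕ∞) p with hNp | hNp
  · exact ⟨⟨N, hNp⟩, fun k hk y hy => (hN y hy).1 k hk, fun k _ => hC k⟩
  · -- For `p < N` the largest order `p` itself serves, as there are no orders above it.
    lift p to ℕ using (hNp.trans_le le_top).ne
    exact ⟨⟨p, le_rfl⟩, fun k hk => absurd hk (not_lt_of_ge (by exact_mod_cast k.2)),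
      fun k _ => hC k⟩
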